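/- Let $d,q\in\mathbb N$, let $U\subseteq\mathbb R^d$ be a domain (more generally, any Borel measurable set), and let $(\Omega,\mathcal F,\mathbb P)$ be a probability space, complete or not. Let $L^2(U;\mathbb R^q)$ be the real Hilbert space of square integrable vector fields on $U$ with inner product $(\mathbf u,\mathbf v)=\int_U \mathbf u^{\rm T}\mathbf v\,dx$, let $L^2_{\mathbb P}(\Omega)$ be the real Hilbert space of square integrable random variables, and let $L^2_{\mathbb P}(\Omega;L^2(U;\mathbb R^q))$ be the Bochner space of (classes of) strongly measurable, square integrable maps $\Omega\to L^2(U;\mathbb R^q)$, with inner product $\int_\Omega(\mathbf u(\omega),\mathbf v(\omega))\,d\mathbb P(\omega)$. Let $L^2(U;\mathbb R^q)\otimes L^2_{\mathbb P}(\Omega)$ denote the Hilbert tensor product, i.e. the completion of the algebraic tensor product over $\mathbb R$ with respect to the inner product determined by $(\mathbf v\otimes s,\mathbf v'\otimes s')=(\mathbf v,\mathbf v')\,(s,s')$. Then there is a surjective linear isometry $$\Phi: L^2(U;\mathbb R^q)\otimes L^2_{\mathbb P}(\Omega)\longrightarrow L^2_{\mathbb P}(\Omega;L^2(U;\mathbb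 R^q))$$ such that, for all $\mathbf v\in L^2(U;\mathbb R^q)$ and $s\in L^2_{\mathbb P}(\Omega)$, $\Phi(\mathbf v\otimes s)(\omega)=s(\omega)\,\mathbf v$ for $\mathbb P$-almost every $\omega$. In particular, the two Hilbert spaces are isometrically isomorphic. -/

import Mathlib

open MeasureTheory
open scoped TensorProduct

/-- The real Hilbert space `L²(U; ℝ^q)` of (classes of) square integrable vector fields on
`U ⊆ ℝ^d`, for Lebesgue measure, with inner product `(u, v) = ∫_U uᵀ v dx`. -/
abbrev L2Field {d : ℕ} (U : Set (EuclideanSpace ℝ (Fin d))) (q : ℕ) : Type :=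
  Lp (EuclideanSpace ℝ (Fin q)) 2 (volume.restrict U)

/-- The Hilbert tensor product of two real inner product spaces: the completion of the algebraic
tensor product for the inner product with `⟪a ⊗ b, a' ⊗ b'⟫ = ⟪a, a'⟫ * ⟪b, b'⟫`. -/
abbrev HilbertTensor (H S : Type*) [NormedAddCommGroup H] [InnerProductSpace ℝ H]
    [NormedAddCommGroup S] [InnerProductSpace ℝ S] : Type _ :=
  UniformSpace.Completion (H ⊗[ℝ] S)

/-- The elementary tensor `a ⊗ b` as an element of the Hilbert tensor product. -/
noncomputable def HilbertTensor.tmul {H S : Type*} [NormedAddCommGroup H] [InnerProductSpace ℝ H]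
    [NormedAddCommGroup S] [InnerProductSpace ℝ S] (a : H) (b : S) : HilbertTensor H S :=
  ((a ⊗ₜ[ℝ] b : H ⊗[ℝ] S) : UniformSpace.Completion (H ⊗[ℝ] S))

/-! The bilinear map `(v, s) ↦ s(·) v` multiplies inner products, because
`∫ ⟪s v, t w⟫ dμ = ⟪v, w⟫ ⟪s, t⟫`, so it induces an isometry on the algebraic tensor product. The
image of this isometry contains the vector-valued simple functions, which are dense in the Bochner
space. An isometry with dense range in a complete space exhibits that space as the completion of
its domain. -/

section BilinearIsometry

variable {𝕜 E F G : Type*} [RCLike 𝕜] [NormedAddCommGroup E] [InnerProductSpace 𝕜 E]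
  [NormedAddCommGroup F] [InnerProductSpace 𝕜 F] [SeminormedAddCommGroup G] [InnerProductSpace 𝕜 G]

theorem inner_lift_lift (B : E →ₗ[𝕜] F →ₗ[𝕜] G)
    (hB : ∀ a b a' b', inner 𝕜 (B a b) (B a' b') = inner 𝕜 a a' * inner 𝕜 b b')
    (x y : E ⊗[𝕜] F) :
    inner 𝕜 (TensorProduct.lift B x) (TensorProduct.lift B y) = inner 𝕜 x y := by
  induction x with
  | zero => simp only [map_zero, inner_zero_left]
  | add x₁ x₂ h₁ h₂ => rw [map_add, inner_add_left, inner_add_left, h₁, h₂]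
  | tmul a b =>
    induction y with
    | zero => simp only [map_zero, inner_zero_right]
    | add y₁ y₂ h₁ h₂ => rw [map_add, inner_add_right, inner_add_right, h₁, h₂]
    | tmul a' b' =>
      rw [TensorProduct.lift.tmul, TensorProduct.lift.tmul, hB, TensorProduct.inner_tmul]

/-- The universal property of the algebraic tensor product of inner product spaces for isometries:
a bilinear map that multiplies inner products induces a linear isometry on the tensor product. -/
noncomputable def liftLinearIsometry (B : E →ₗ[𝕜] F →ₗ[𝕜] G)
    (hB : ∀ a b a' b', inner 𝕜 (B a b) (B a' b') = inner 𝕜 a a' * inner 𝕜 b b') :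
    E ⊗[𝕜] F →ₗᵢ[𝕜] G :=
  (TensorProduct.lift B).isometryOfInner (inner_lift_lift B hB)

end BilinearIsometry

section Completion

variable {𝕜 E F : Type*} [NormedField 𝕜] [SeminormedAddCommGroup E] [NormedSpace 𝕜 E]
  [NormedAddCommGroup F] [NormedSpace 𝕜 F] [CompleteSpace F]

/-- The extension of a linear isometry with dense range in a Banach space to an isometric
isomorphism from the completion of its domain; that is, any such isometry is a completion. -/
noncomputable def completionEquivOfDenseRange (f : E →ₗᵢ[𝕜] F) (hf : DenseRange f) :
    UniformSpace.Completion E ≃ₗᵢ[𝕜] F :=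
  (LinearEquiv.refl 𝕜 E).extendOfIsometry
    (UniformSpace.Completion.toComplₗᵢ (𝕜 := 𝕜)).toLinearMap f.toLinearMap
    UniformSpace.Completion.denseRange_coe hf
    fun x => (f.norm_map x).trans (UniformSpace.Completion.norm_coe x).symm

theorem completionEquivOfDenseRange_coe (f : E →ₗᵢ[𝕜] F) (hf : DenseRange f) (x : E) :
    completionEquivOfDenseRange f hf x = f x :=
  LinearEquiv.extendOfIsometry_eq (LinearEquiv.refl 𝕜 E)
    (UniformSpace.Completion.toComplₗᵢ (𝕜 := 𝕜)).toLinearMap f.toLinearMap _ hf _ x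

end Completion

section SmulConst

variable {𝕜 E Ω : Type*} [NontriviallyNormedField 𝕜] [NormedAddCommGroup E] [NormedSpace 𝕜 E]
  [MeasurableSpace Ω] {p : ENNReal} {μ : Measure Ω}

variable (𝕜 E p μ) in
/-- The bilinear map sending a vector `v` and a scalar function `s` in `Lᵖ` to the vector-valued
function `ω ↦ s ω • v` in `Lᵖ`. -/
noncomputable def smulConstLp : E →ₗ[𝕜] Lp 𝕜 p μ →ₗ[𝕜] Lp E p μ :=
  (ContinuousLinearMap.lsmul 𝕜 𝕜).flip.compLpₗ₂ p μ

theorem coeFn_smulConstLp (v : E) (s : Lp 𝕜 p μ) :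
    smulConstLp 𝕜 E p μ v s =ᵐ[μ] fun ω => s ω • v :=
  ContinuousLinearMap.coeFn_compLp ((ContinuousLinearMap.lsmul 𝕜 𝕜).flip v) s

theorem smulConstLp_indicatorConstLp_one {A : Set Ω} (hA : MeasurableSet A) (hμA : μ A ≠ ⊤)
    (v : E) :
    smulConstLp 𝕜 E p μ v (indicatorConstLp p hA hμA 1) = indicatorConstLp p hA hμA v := by
  apply Lp.ext
  filter_upwards [coeFn_smulConstLp v (indicatorConstLp p hA hμA (1 : 𝕜)),
    indicatorConstLp_coeFn (p := p) (hs := hA) (hμs := hμA) (c := (1 : 𝕜)),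
    indicatorConstLp_coeFn (p := p) (hs := hA) (hμs := hμA) (c := v)] with ω hsmul hone hv
  rw [hsmul, hone, hv, ← Set.indicator_smul_const_apply, one_smul]

theorem denseRange_lift_smulConstLp [Fact (1 ≤ p)] (hp : p ≠ ⊤) :
    DenseRange (TensorProduct.lift (smulConstLp 𝕜 E p μ)) := by
  intro f
  induction f using Lp.induction hp with
  | indicatorConst v hA hμA =>
    refine subset_closure ⟨v ⊗ₜ indicatorConstLp p hA hμA.ne 1, ?_⟩
    exact smulConstLp_indicatorConstLp_one hA hμA.ne v
  | add _ _ _ hf hg =>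
    exact (LinearMap.range
      (TensorProduct.lift (smulConstLp 𝕜 E p μ))).topologicalClosure.add_mem hf hg
  | isClosed => exact isClosed_closure

end SmulConst

section Bochner

variable {𝕜 H Ω : Type*} [RCLike 𝕜] [NormedAddCommGroup H] [InnerProductSpace 𝕜 H]
  [MeasurableSpace Ω] {μ : Measure Ω}

theorem inner_smulConstLp_smulConstLp (v : H) (s : Lp 𝕜 2 μ) (w : H) (t : Lp 𝕜 2 μ) :
    inner 𝕜 (smulConstLp 𝕜 H 2 μ v s) (smulConstLp 𝕜 H 2 μ w t) =
      inner 𝕜 v w * inner 𝕜 s t := by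
  rw [L2.inner_def, L2.inner_def, ← integral_const_mul]
  refine integral_congr_ae ?_
  filter_upwards [coeFn_smulConstLp v s, coeFn_smulConstLp w t] with ω hvs hwt
  rw [hvs, hwt, inner_smul_left, inner_smul_right, RCLike.inner_apply]
  ring

theorem proposition3_general [CompleteSpace H] (μ : Measure Ω) :
    ∃ Φ : UniformSpace.Completion (H ⊗[𝕜] Lp 𝕜 2 μ) ≃ₗᵢ[𝕜] Lp H 2 μ,
      ∀ (v : H) (s : Lp 𝕜 2 μ), Φ (v ⊗ₜ[𝕜] s : H ⊗[𝕜] Lp 𝕜 2 μ) =ᵐ[μ] fun ω => s ω • v := by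
  let ι : H ⊗[𝕜] Lp 𝕜 2 μ →ₗᵢ[𝕜] Lp H 2 μ :=
    liftLinearIsometry (smulConstLp 𝕜 H 2 μ) inner_smulConstLp_smulConstLp
  have hι : DenseRange ι := denseRange_lift_smulConstLp ENNReal.ofNat_ne_top
  refine ⟨completionEquivOfDenseRange ι hι, fun v s => ?_⟩
  rw [completionEquivOfDenseRange_coe]
  exact coeFn_smulConstLp v s

end Bochner

theorem proposition3 {d q : ℕ} (U : Set (EuclideanSpace ℝ (Fin d))) (hU : MeasurableSet U)
    {Ω : Type*} [MeasurableSpace Ω] (P : Measure Ω) [IsProbabilityMeasure P] :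
    ∃ Φ : HilbertTensor (L2Field U q) (Lp ℝ 2 P) ≃ₗᵢ[ℝ] Lp (L2Field U q) 2 P,
      ∀ (v : L2Field U q) (s : Lp ℝ 2 P),
        (Φ (HilbertTensor.tmul v s) : Ω → L2Field U q) =ᵐ[P] fun ω => s ω • v :=
  proposition3_general P
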